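/- Let $C=\{0,1\}^{\mathbb N}$ be the Cantor space with the product topology, metrized by $d(\sigma,\sigma)=0$ and $d(\sigma,\tau)=1/n$ for $\sigma\neq\tau$, where $n$ is the least positive integer with $\sigma(n)\neq\tau(n)$. Let $\mathcal C(C)$ be the space of all continuous maps $f:C\to C$ with the metric $\tilde d(f,g)=\max_{x\in C}d(f(x),g(x))$, and let $\mathcal M(C)$ be the space of all Borel probability measures on $C$ with the Prokhorov metric $$d_P(\mu,\nu)=\inf\{\delta>0:\ \mu(X)\le\nu(X^\delta)+\delta\ \text{ and }\ \nu(X)\le\mu(X^\delta)+\delta\ \text{ for all Borel } X\subset C\},$$ where $X^\delta=\{x\in C: d(x,X)<\delta\}$. For $f\in\mathcal C(C)$ let $\tilde f:\mathcal M(C)\to\mathcal M(C)$ be the induced map $(\tilde f(\mu))(X)=\mu(f^{-1}(X))$ for Borel sets $X\subset C$. Then for the generic $f\in\mathcal C(C)$, the map $\tilde f$ has no Li-Yorke pair. That is, the set of all $f\in\mathcal C(C)$ for which there are $\mu,\nu\in\mathcal M(C)$ with $$\liminf_{n\to\infty}d_P(\tilde f^{\,n}(\mu),\tilde f^{\,n}(\nu))=0\quad\text{and}\quad\limsup_{n\to\infty}d_P(\tilde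 f^{\,n}(\mu),\tilde f^{\,n}(\nu))>0$$ is of the first category (meagre) in the Baire space $\mathcal C(C)$. -/

import Mathlib

open Filter MeasureTheory

namespace CantorInduced

/-! ### The Cantor space and its metric -/

/-- The Cantor space `{0,1}^ℕ`. -/
def Cantor : Type := ℕ → Bool

namespace Cantor

/-- The product topology, `{0,1}` being discrete. -/
instance : TopologicalSpace Cantor := inferInstanceAs (TopologicalSpace (ℕ → Bool))

instance : CompactSpace Cantor := inferInstanceAs (CompactSpace (ℕ → Bool))

/-- The distance of two distinct points is `1 / n`, where `n` is the position, counted from `1`,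
of the first coordinate in which they differ. Coordinates are indexed from `0` here, and
`PiNat.firstDiff σ τ` is the least index at which `σ` and `τ` differ, so `n = firstDiff σ τ + 1`. -/
noncomputable instance : Dist Cantor :=
  ⟨fun σ τ => open Classical in
    if σ = τ then 0 else 1 / ((PiNat.firstDiff (E := fun _ => Bool) σ τ : ℝ) + 1)⟩

theorem dist_self' (σ : Cantor) : dist σ σ = 0 := by simp [dist]

theorem dist_of_ne {σ τ : Cantor} (h : σ ≠ τ) :
    dist σ τ = 1 / ((PiNat.firstDiff (E := fun _ => Bool) σ τ : ℝ) + 1) := by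
  simp [dist, h]

theorem dist_nonneg' (σ τ : Cantor) : 0 ≤ dist σ τ := by
  by_cases h : σ = τ
  · rw [h, dist_self']
  · rw [dist_of_ne h]; positivity

theorem dist_lt_iff (σ τ : Cantor) (n : ℕ) :
    dist σ τ < 1 / ((n : ℝ) + 1) ↔ ∀ i ≤ n, σ i = τ i := by
  by_cases h : σ = τ
  · subst h
    simp only [dist_self', implies_true, iff_true]
    positivity
  · rw [dist_of_ne h, one_div_lt_one_div (by positivity) (by positivity)]
    have h1 : ((n : ℝ) + 1 < (PiNat.firstDiff (E := fun _ => Bool) σ τ : ℝ) + 1) ↔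
        n < PiNat.firstDiff (E := fun _ => Bool) σ τ := by
      constructor
      · intro h; have := (add_lt_add_iff_right (1 : ℝ)).1 h; exact_mod_cast this
      · intro h; have : (n : ℝ) < _ := Nat.cast_lt.2 h; linarith
    rw [h1]
    constructor
    · intro hn i hi
      exact PiNat.apply_eq_of_lt_firstDiff (E := fun _ => Bool) (lt_of_le_of_lt hi hn)
    · intro hi
      by_contra! hn
      exact PiNat.apply_firstDiff_ne (E := fun _ => Bool) h (hi _ hn)

theorem dist_comm' (σ τ : Cantor) : dist σ τ = dist τ σ := by
  by_cases h : σ = τ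
  · rw [h]
  · rw [dist_of_ne h, dist_of_ne (Ne.symm h)]
    exact congrArg (fun n : ℕ => 1 / ((n : ℝ) + 1))
      (PiNat.firstDiff_comm (E := fun _ => Bool) σ τ)

theorem eq_of_dist_eq_zero' (σ τ : Cantor) (h : dist σ τ = 0) : σ = τ := by
  by_contra hne
  rw [dist_of_ne hne] at h
  have : 0 < 1 / ((PiNat.firstDiff (E := fun _ => Bool) σ τ : ℝ) + 1) := by positivity
  exact this.ne' h

theorem dist_triangle' (σ τ υ : Cantor) : dist σ υ ≤ dist σ τ + dist τ υ := by
  by_cases h : σ = υ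
  · rw [h, dist_self']
    exact add_nonneg (dist_nonneg' _ _) (dist_nonneg' _ _)
  by_contra! hlt
  have h1 : dist σ τ < dist σ υ := by linarith [dist_nonneg' τ υ]
  have h2 : dist τ υ < dist σ υ := by linarith [dist_nonneg' σ τ]
  rw [dist_of_ne h] at h1 h2
  rw [dist_lt_iff] at h1 h2
  exact PiNat.apply_firstDiff_ne (E := fun _ => Bool) h ((h1 _ le_rfl).trans (h2 _ le_rfl))

theorem isOpen_iff' (s : Set Cantor) :
    IsOpen s ↔ ∀ x ∈ s, ∃ ε > 0, ∀ y, dist x y < ε → y ∈ s := by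
  rw [show IsOpen s ↔ _ from PiNat.isOpen_iff_dist (E := fun _ => Bool) s]
  have key : ∀ (x y : ℕ → Bool) (n : ℕ), (∀ i < n, x i = y i) →
      (PiNat.dist (E := fun _ => Bool)).dist x y ≤ (1 / 2) ^ n := by
    intro x y n h
    exact PiNat.mem_cylinder_iff_dist_le.1 (fun i hi => h i hi)
  refine forall₂_congr fun x _ => ⟨?_, ?_⟩
  · rintro ⟨ε, hε, h⟩
    obtain ⟨n, hn⟩ := exists_pow_lt_of_lt_one hε (by norm_num : (1 / 2 : ℝ) < 1)
    refine ⟨1 / ((n : ℝ) + 1), by positivity, fun y hy => h y ?_⟩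
    exact (key x y n fun i hi => (dist_lt_iff x y n).1 hy i hi.le).trans_lt hn
  · rintro ⟨ε, hε, h⟩
    obtain ⟨n, hn⟩ := exists_nat_one_div_lt hε
    refine ⟨(1 / 2) ^ n, by positivity, fun y hy => h y (lt_trans ?_ hn)⟩
    exact (dist_lt_iff x y n).2 fun i hi => PiNat.apply_eq_of_dist_lt (E := fun _ => Bool) hy hi

/-- The metric above; it is compatible with the product topology. -/
noncomputable instance : MetricSpace Cantor :=
  MetricSpace.ofDistTopology dist dist_self' dist_comm' dist_triangle' isOpen_iff'
    eq_of_dist_eq_zero'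

/-- The Borel σ-algebra. -/
instance : MeasurableSpace Cantor := borel Cantor

instance : BorelSpace Cantor := ⟨rfl⟩

end Cantor

/-! ### Generic elements, induced maps, Li-Yorke pairs -/

/-- The generic element of the Baire space `Z` has the property `P`: the elements without it form
a set of the first category. -/
def Generic {Z : Type*} [TopologicalSpace Z] [BaireSpace Z] (P : Z → Prop) : Prop :=
  IsMeagre {z : Z | ¬ P z}

/-- The induced map `μ ↦ μ ∘ f⁻¹` on the space of Borel probability measures on `M`;
`LevyProkhorov (ProbabilityMeasure M)` is that space with the Prokhorov metric. -/
noncomputable def inducedMap {M : Type*} [MetricSpace M] [CompactSpace M] [MeasurableSpace M]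
    [BorelSpace M] (f : C(M, M)) (μ : LevyProkhorov (ProbabilityMeasure M)) :
    LevyProkhorov (ProbabilityMeasure M) :=
  LevyProkhorov.ofMeasure (μ.toMeasure.map f.continuous.measurable.aemeasurable)

/-- `(x, y)` is a Li-Yorke pair for the self-map `F` of the bounded metric space `X`. -/
def IsLiYorkePair {X : Type*} [MetricSpace X] [BoundedSpace X] (F : X → X) (x y : X) : Prop :=
  liminf (fun n : ℕ => dist (F^[n] x) (F^[n] y)) atTop = 0 ∧
    0 < limsup (fun n : ℕ => dist (F^[n] x) (F^[n] y)) atTop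

/-- The Prokhorov distance of two probability measures is at most `1`. -/
instance {M : Type*} [MetricSpace M] [MeasurableSpace M] [BorelSpace M] :
    BoundedSpace (LevyProkhorov (ProbabilityMeasure M)) := by
  refine ⟨Metric.isBounded_iff.2 ⟨1, fun μ _ ν _ => ?_⟩⟩
  rw [LevyProkhorov.dist_probabilityMeasure_def, levyProkhorovDist]
  refine ENNReal.toReal_le_of_le_ofReal zero_le_one ?_
  simpa using levyProkhorovEDist_le_max_measure_univ
    (μ.toMeasure : Measure M) (ν.toMeasure : Measure M)

end CantorInduced

namespace CantorInduced

open Metric Set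

/-! Distance below `1 / (k + 1)` in the Cantor space means agreement in coordinates `0, …, k`, so
preserving that scale means sending each cylinder of this depth into another one. Every continuous
map is uniformly approximated by maps constant on the cylinders of some large depth, and preserving
a scale survives small perturbations; by Baire category, the generic map preserves arbitrarily small
scales. If `f` preserves the scale `r`, the Prokhorov inequalities at `r` pass from a pair of
measures to its images with no loss. Once two orbits come within distance less than `r`, they stay
within `r` forever. Hence liminf zero forces limsup zero. -/

/-- Points at distance less than `r` have images at distance less than `r`. -/
def PreservesScale {X : Type*} [Dist X] (r : ℝ) (f : X → X) : Prop :=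
  ∀ x y, dist x y < r → dist (f x) (f y) < r

section Induced

variable {M : Type*} [MetricSpace M] [CompactSpace M] [MeasurableSpace M] [BorelSpace M]

/-- The inequalities defining the Prokhorov metric hold at `r`. -/
def ProkhorovClose (r : ℝ) (μ ν : LevyProkhorov (ProbabilityMeasure M)) : Prop :=
  ∀ B, MeasurableSet B →
    (μ.toMeasure : Measure M) B ≤
      (ν.toMeasure : Measure M) (thickening r B) + ENNReal.ofReal r ∧
    (ν.toMeasure : Measure M) B ≤
      (μ.toMeasure : Measure M) (thickening r B) + ENNReal.ofReal r

omit [CompactSpace M] in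
theorem ProkhorovClose.dist_le {r : ℝ} (hr : 0 ≤ r)
    {μ ν : LevyProkhorov (ProbabilityMeasure M)} (h : ProkhorovClose r μ ν) :
    dist μ ν ≤ r := by
  rw [LevyProkhorov.dist_probabilityMeasure_def, levyProkhorovDist]
  refine ENNReal.toReal_le_of_le_ofReal hr (sInf_le fun B hB => ?_)
  rw [ENNReal.toReal_ofReal hr]
  exact h B hB

omit [CompactSpace M] in
theorem ProkhorovClose.of_dist_lt {r : ℝ} {μ ν : LevyProkhorov (ProbabilityMeasure M)}
    (h : dist μ ν < r) : ProkhorovClose r μ ν := by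
  have hr : 0 ≤ r := dist_nonneg.trans h.le
  rw [LevyProkhorov.dist_probabilityMeasure_def, levyProkhorovDist,
    ← ENNReal.lt_ofReal_iff_toReal_lt (levyProkhorovEDist_ne_top _ _)] at h
  intro B hB
  have h1 := left_measure_le_of_levyProkhorovEDist_lt h hB
  have h2 := right_measure_le_of_levyProkhorovEDist_lt h hB
  rw [ENNReal.toReal_ofReal hr] at h1 h2
  exact ⟨h1, h2⟩

-- This inclusion is the only way scale preservation enters the estimates on measures.
omit [MeasurableSpace M] [CompactSpace M] [BorelSpace M] in
theorem PreservesScale.thickening_preimage_subset {r : ℝ} {f : M → M}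
    (hf : PreservesScale r f) (B : Set M) :
    thickening r (f ⁻¹' B) ⊆ f ⁻¹' thickening r B := by
  intro x hx
  obtain ⟨y, hy, hxy⟩ := mem_thickening_iff.1 hx
  exact mem_thickening_iff.2 ⟨f y, hy, hf x y hxy⟩

theorem inducedMap_apply (f : C(M, M)) (μ : LevyProkhorov (ProbabilityMeasure M))
    {B : Set M} (hB : MeasurableSet B) :
    ((inducedMap f μ).toMeasure : Measure M) B = (μ.toMeasure : Measure M) (f ⁻¹' B) :=
  ProbabilityMeasure.map_apply' _ f.continuous.measurable.aemeasurable hB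

/-- The hypothesis is applied to `f ⁻¹' B`, whose thickening lies in the preimage of the thickening
of `B`. The argument runs through the inequalities at `r` itself, not the distance, because `f` is
known to preserve only this one scale. -/
theorem ProkhorovClose.inducedMap {r : ℝ} {f : C(M, M)} (hf : PreservesScale r f)
    {μ ν : LevyProkhorov (ProbabilityMeasure M)} (h : ProkhorovClose r μ ν) :
    ProkhorovClose r (inducedMap f μ) (inducedMap f ν) := by
  intro B hB
  simp only [inducedMap_apply f _ hB, inducedMap_apply f _ isOpen_thickening.measurableSet]
  obtain ⟨h1, h2⟩ := h _ (f.continuous.measurable hB)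
  have hs := hf.thickening_preimage_subset B
  exact ⟨h1.trans (by gcongr), h2.trans (by gcongr)⟩

theorem ProkhorovClose.iterate_inducedMap {r : ℝ} {f : C(M, M)} (hf : PreservesScale r f)
    {μ ν : LevyProkhorov (ProbabilityMeasure M)} (h : ProkhorovClose r μ ν) (n : ℕ) :
    ProkhorovClose r ((CantorInduced.inducedMap f)^[n] μ)
      ((CantorInduced.inducedMap f)^[n] ν) := by
  induction n with
  | zero => exact h
  | succ n ih =>
    simp only [Function.iterate_succ_apply']
    exact ih.inducedMap hf

/-- A map preserving arbitrarily small scales induces a map without Li-Yorke pairs. -/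
theorem not_isLiYorkePair_inducedMap {f : C(M, M)}
    (hf : ∀ ε > 0, ∃ r, 0 < r ∧ r < ε ∧ PreservesScale r f)
    (μ ν : LevyProkhorov (ProbabilityMeasure M)) :
    ¬ IsLiYorkePair (inducedMap f) μ ν := by
  rintro ⟨hinf, hsup⟩
  -- A preserved scale strictly below the limsup; the contradiction will be that the limsup is at
  -- most `r`.
  obtain ⟨r, hr, hrs, hfr⟩ := hf _ hsup
  -- Real-valued liminf and limsup obey the expected inequalities only under boundedness, supplied
  -- here by the bounded space and by nonnegativity of the distance.
  obtain ⟨C, hC⟩ := Metric.isBounded_iff.1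
    (Bornology.IsBounded.all (univ : Set (LevyProkhorov (ProbabilityMeasure M))))
  have hco : atTop.IsCoboundedUnder (· ≥ ·)
      fun n : ℕ => dist ((inducedMap f)^[n] μ) ((inducedMap f)^[n] ν) :=
    (isBoundedUnder_of ⟨C, fun _ => hC (mem_univ _) (mem_univ _)⟩).isCoboundedUnder_ge
  have hco' : atTop.IsCoboundedUnder (· ≤ ·)
      fun n : ℕ => dist ((inducedMap f)^[n] μ) ((inducedMap f)^[n] ν) :=
    (isBoundedUnder_of ⟨0, fun _ => dist_nonneg⟩).isCoboundedUnder_le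
  obtain ⟨n, hn⟩ := (frequently_lt_of_liminf_lt hco (hinf.trans_lt hr)).exists
  refine hrs.not_ge (limsup_le_of_le hco' ?_)
  filter_upwards [eventually_ge_atTop n] with m hm
  obtain ⟨k, rfl⟩ := Nat.exists_eq_add_of_le' hm
  rw [Function.iterate_add_apply, Function.iterate_add_apply]
  exact ((ProkhorovClose.of_dist_lt hn).iterate_inducedMap hfr k).dist_le hr.le

end Induced

namespace Cantor

/-- The point obtained from `σ` by replacing all coordinates after the `k`-th by `false`. -/
def truncate (k : ℕ) (σ : Cantor) : Cantor := fun i => if i ≤ k then σ i else false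

theorem dist_truncate_lt (k : ℕ) (σ : Cantor) : dist (truncate k σ) σ < 1 / ((k : ℝ) + 1) :=
  (dist_lt_iff _ _ _).2 fun i hi => by simp [truncate, hi]

theorem truncate_eq_of_dist_lt {k : ℕ} {σ τ : Cantor} (h : dist σ τ < 1 / ((k : ℝ) + 1)) :
    truncate k σ = truncate k τ := by
  have h' := (dist_lt_iff _ _ _).1 h
  funext i
  by_cases hi : i ≤ k
  · simp [truncate, hi, h' i hi]
  · simp [truncate, hi]

theorem continuous_truncate (k : ℕ) : Continuous (truncate k) := by
  refine Metric.continuous_iff.2 fun σ ε hε => ⟨1 / ((k : ℝ) + 1), by positivity, fun τ h => ?_⟩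
  rwa [truncate_eq_of_dist_lt h, dist_self]

/-- If `g` is within `1 / (k + 1)` of `f`, then `g x` and `f x` agree up to coordinate `k` for every
`x`, so both maps act identically on cylinders of that depth. -/
theorem isOpen_setOf_preservesScale (k : ℕ) :
    IsOpen {f : C(Cantor, Cantor) | PreservesScale (1 / ((k : ℝ) + 1)) f} := by
  refine Metric.isOpen_iff.2 fun f hf => ⟨1 / ((k : ℝ) + 1), by positivity, fun g hg x y hxy => ?_⟩
  have hgf : ∀ z, dist (g z) (f z) < 1 / ((k : ℝ) + 1) := fun z =>
    (ContinuousMap.dist_apply_le_dist z).trans_lt hg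
  refine (dist_lt_iff _ _ _).2 fun i hi => ?_
  rw [(dist_lt_iff _ _ _).1 (hgf x) i hi, (dist_lt_iff _ _ _).1 (hgf y) i hi]
  exact (dist_lt_iff _ _ _).1 (hf x y hxy) i hi

/-- Precomposing `f` with a truncation makes it constant on cylinders, so the scale is trivially
preserved, and moves it little by uniform continuity. -/
theorem dense_setOf_exists_preservesScale (m : ℕ) :
    Dense {f : C(Cantor, Cantor) | ∃ k, m ≤ k ∧ PreservesScale (1 / ((k : ℝ) + 1)) f} := by
  refine Metric.dense_iff.2 fun f ε hε => ?_
  obtain ⟨δ, hδ, h⟩ := Metric.uniformContinuous_iff.1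
    (CompactSpace.uniformContinuous_of_continuous f.continuous) ε hε
  obtain ⟨N, hN⟩ := exists_nat_one_div_lt hδ
  -- Depth at least `m` makes the scale small enough; depth at least `N` moves points by less than
  -- `δ`.
  refine ⟨⟨fun x => f (truncate (max m N) x), f.continuous.comp (continuous_truncate _)⟩,
    ?_, max m N, le_max_left _ _, fun x y hxy => ?_⟩
  · refine (ContinuousMap.dist_lt_iff hε).2 fun x => h ((dist_truncate_lt _ x).trans_le ?_)
    refine le_trans ?_ hN.le
    exact one_div_le_one_div_of_le (by positivity)
      (by gcongr; exact le_max_right _ _)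
  · simp only [ContinuousMap.coe_mk, truncate_eq_of_dist_lt hxy, dist_self]
    positivity

/-- The generic self-map of the Cantor space preserves arbitrarily small scales. -/
theorem eventually_residual_preservesScale :
    ∀ᶠ f : C(Cantor, Cantor) in residual C(Cantor, Cantor),
      ∀ m : ℕ, ∃ k, m ≤ k ∧ PreservesScale (1 / ((k : ℝ) + 1)) f := by
  refine eventually_countable_forall.2 fun m =>
    residual_of_dense_open ?_ (dense_setOf_exists_preservesScale m)
  have : {f : C(Cantor, Cantor) | ∃ k, m ≤ k ∧ PreservesScale (1 / ((k : ℝ) + 1)) f} =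
      ⋃ k, ⋃ _ : m ≤ k, {f : C(Cantor, Cantor) | PreservesScale (1 / ((k : ℝ) + 1)) f} := by
    ext f; simp
  rw [this]
  exact isOpen_iUnion fun k => isOpen_iUnion fun _ => isOpen_setOf_preservesScale k

end Cantor

end CantorInduced

theorem corollary3p5 :
    CantorInduced.Generic fun f : C(CantorInduced.Cantor, CantorInduced.Cantor) =>
      ¬ ∃ μ ν : LevyProkhorov (ProbabilityMeasure CantorInduced.Cantor),
        CantorInduced.IsLiYorkePair (CantorInduced.inducedMap f) μ ν := by
  unfold CantorInduced.Generic IsMeagre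
  filter_upwards [CantorInduced.Cantor.eventually_residual_preservesScale] with f hf
  refine not_not_intro ?_
  rintro ⟨μ, ν, h⟩
  refine CantorInduced.not_isLiYorkePair_inducedMap (fun ε hε => ?_) μ ν h
  obtain ⟨m, hm⟩ := exists_nat_one_div_lt hε
  obtain ⟨k, hk, hfk⟩ := hf m
  refine ⟨1 / ((k : ℝ) + 1), by positivity, lt_of_le_of_lt ?_ hm, hfk⟩
  exact one_div_le_one_div_of_le (by positivity) (by gcongr)
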